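/- Let $\alpha>0$ and, for $0<a<1$, let $w(x,a)=(1-x^2)^{\alpha}\,(1-\chi_{(-a,a)}(x))$ on $[-1,1]$, where $\chi_{(-a,a)}$ is the indicator function of $(-a,a)$. Let $P_n(x,a)$ ($n=0,1,2,\dots$) be the monic orthogonal polynomials of degree $n$ for this weight, obtained from the monomials by the Gram–Schmidt process, and let $$h_n(a)=\int_{-1}^{1}P_n(x,a)^2\,w(x,a)\,dx .$$ Let $\beta_n(a)$ be the coefficients of the recurrence $xP_n(x,a)=P_{n+1}(x,a)+\beta_n(a)P_{n-1}(x,a)$, with $P_{-1}=0$ and $\beta_0=0$, and put $$R_n(a)=\frac{2P_n(a,a)^2(1-a^2)^{\alpha}}{h_n(a)},\qquad r_n(a)=\frac{2P_n(a,a)P_{n-1}(a,a)(1-a^2)^{\alpha}}{h_{n-1}(a)}\quad(n\ge 1),\qquad r_0(a)=0 .$$ Then, for every integer $n\ge 0$ and every $a\in(0,1)$, these objects are well defined: $P_n(\cdot,a)$ is monic of degree $n$, it is orthogonal to $P_j(\cdot,a)$ for all $j\ne n$, $h_n(a)>0$, and the recurrence above holds. Moreover $R_n(a)>0$ and $aR_n(a)+2n+2\alpha+1>0$,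 the functions $R_n$ and $r_n$ are differentiable at $a$, and the following hold. 1. If $2n+2\alpha-1\neq 0$ (in particular whenever $n\ge1$), then $$\beta_n(a)=\frac{\left[(1-a^2)r_n^2(a)+2(n+\alpha)r_n(a)+n^2+2n\alpha\right]R_n(a)-(2n+2\alpha+1)\,a\,r_n^2(a)}{(2n+2\alpha-1)R_n(a)\,(aR_n(a)+2n+2\alpha+1)} .$$ 2. $R_n$ and $r_n$ satisfy the coupled Riccati equations $$r_n'(a)=\frac{\left[(a^2-1)R_n^2(a)+2a(2n+2\alpha+1)R_n(a)+(2n+2\alpha+1)^2\right]r_n^2(a)}{(1-a^2)R_n(a)(aR_n(a)+2n+2\alpha+1)}-\frac{2(n+\alpha)R_n(a)r_n(a)+n(n+2\alpha)R_n(a)}{(1-a^2)(aR_n(a)+2n+2\alpha+1)},$$ $$R_n'(a)=R_n^2(a)+\frac{2a^2(n+\alpha)-2(a^2-1)r_n(a)}{a(a^2-1)}\,R_n(a)-\frac{2(2n+2\alpha+1)}{a^2-1}\,r_n(a).$$ -/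

import Mathlib

open scoped Polynomial

noncomputable section

namespace JacobiGap

/-- The Jacobi weight with a gap, `w(x,a) = (1 - x²)^α (1 - χ_{(-a,a)}(x))`. -/
def weight (α a x : ℝ) : ℝ :=
  (1 - x ^ 2) ^ α * (1 - (Set.Ioo (-a) a).indicator (fun _ => (1 : ℝ)) x)

/-- The bilinear form `∫_{-1}^{1} p(x) q(x) w(x,a) dx` on real polynomials. -/
def pairing (α a : ℝ) (p q : ℝ[X]) : ℝ :=
  ∫ x in (-1 : ℝ)..1, p.eval x * q.eval x * weight α a x

/-- The monic orthogonal polynomials `P_n(·,a)` for the weight `w(·,a)`, obtained from the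
monomials by the Gram-Schmidt process. -/
def P (α : ℝ) (n : ℕ) (a : ℝ) : ℝ[X] :=
  Polynomial.X ^ n - ∑ k : Fin n,
    Polynomial.C (pairing α a (Polynomial.X ^ n) (P α k a) / pairing α a (P α k a) (P α k a))
      * P α k a
termination_by n
decreasing_by all_goals exact k.isLt

/-- The squared norm `h_n(a) = ∫_{-1}^{1} P_n(x,a)² w(x,a) dx`. -/
def h (α : ℝ) (n : ℕ) (a : ℝ) : ℝ := pairing α a (P α n a) (P α n a)

/-- The coefficient `β_n(a)` of the recurrence `x P_n = P_{n+1} + β_n P_{n-1}`. As `P_{n-1}` is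
monic of degree `n - 1`, it is the coefficient of `x^(n-1)` in `x P_n - P_{n+1}`. For `n = 0`
the convention is `β_0 P_{-1} = 0`. -/
def β (α : ℝ) : ℕ → ℝ → ℝ
  | 0, _ => 0
  | n + 1, a => (Polynomial.X * P α (n + 1) a - P α (n + 2) a).coeff n

/-- `R_n(a) = 2 P_n(a,a)² (1 - a²)^α / h_n(a)`. -/
def R (α : ℝ) (n : ℕ) (a : ℝ) : ℝ :=
  2 * (P α n a).eval a ^ 2 * (1 - a ^ 2) ^ α / h α n a

/-- `r_n(a) = 2 P_n(a,a) P_{n-1}(a,a) (1 - a²)^α / h_{n-1}(a)`, with `r_0 = 0` by the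
convention `P_{-1} = 0`. -/
def r (α : ℝ) : ℕ → ℝ → ℝ
  | 0, _ => 0
  | n + 1, a =>
      2 * (P α (n + 1) a).eval a * (P α n a).eval a * (1 - a ^ 2) ^ α / h α n a

end JacobiGap

end

noncomputable section

namespace JacobiGap

open Polynomial intervalIntegral

variable {α a : ℝ}

/-! Everything is reduced to the linear functional L that integrates a polynomial against `(1 -
x²)^α` off the gap. Evaluating the three-term recurrence at `a` gives `a R_n = r_{n+1} + r_n`, and
`β_n = h_n / h_{n-1}` gives `β_n R_n R_{n-1} = r_n²`. Integration by parts gives the expansion of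
`(1 - x²) P_n' + n x P_n` in the `P_k` with `k < n`; comparing subleading coefficients yields a
linear difference equation (`linear_relation`). Multiplied by `2n + 2α + 1 + a R_n` it telescopes to
`quadratic_relation`, which is the formula for `β_n`. For the dependence on `a`, differentiating the
orthogonality relations expands `∂_a P_n` in the same basis. In the total derivative of `P_n(a,a)`
the sums from `∂_a P_n` and `∂_x P_n` combine into `∑ (-1)^(n+k) R_k = -r_n / a`, so the logarithmic
derivative is closed in `R_n` and `r_n`. With `h_n' = -R_n h_n` this gives `R_n'` and `r_n'`; `β_n`
is then eliminated from `r_n'`. -/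

/-! ### The moment functional off the gap -/

theorem continuous_jacobi (hα : 0 < α) (p : ℝ[X]) :
    Continuous fun x : ℝ => p.eval x * (1 - x ^ 2) ^ α :=
  p.continuous.mul ((by fun_prop : Continuous fun x : ℝ => 1 - x ^ 2).rpow_const
    fun _ => Or.inr hα.le)

/-- The moment functional of the Jacobi weight restricted to `[-1, -a] ∪ [a, 1]`. -/
def gapFunctional (hα : 0 < α) (a : ℝ) : ℝ[X] →ₗ[ℝ] ℝ where
  toFun p := (∫ x in (-1 : ℝ)..(-a), p.eval x * (1 - x ^ 2) ^ α) +
    ∫ x in a..(1 : ℝ), p.eval x * (1 - x ^ 2) ^ α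
  map_add' p q := by
    simp only [eval_add, add_mul]
    rw [integral_add ((continuous_jacobi hα p).intervalIntegrable _ _)
        ((continuous_jacobi hα q).intervalIntegrable _ _),
      integral_add ((continuous_jacobi hα p).intervalIntegrable _ _)
        ((continuous_jacobi hα q).intervalIntegrable _ _)]
    ring
  map_smul' c p := by
    simp only [eval_smul, smul_eq_mul, mul_assoc, integral_const_mul, RingHom.id_apply, mul_add]

theorem gapFunctional_apply (hα : 0 < α) (a : ℝ) (p : ℝ[X]) :
    gapFunctional hα a p = (∫ x in (-1 : ℝ)..(-a), p.eval x * (1 - x ^ 2) ^ α) +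
      ∫ x in a..(1 : ℝ), p.eval x * (1 - x ^ 2) ^ α := rfl

theorem gapFunctional_C_mul (hα : 0 < α) (a c : ℝ) (p : ℝ[X]) :
    gapFunctional hα a (C c * p) = c * gapFunctional hα a p := by
  rw [← smul_eq_C_mul, map_smul, smul_eq_mul]

theorem weight_of_mem {x : ℝ} (hx : x ∈ Set.Ioo (-a) a) :
    weight α a x = 0 := by
  simp [weight, Set.indicator_of_mem hx]

theorem weight_of_notMem {x : ℝ} (hx : x ∉ Set.Ioo (-a) a) :
    weight α a x = (1 - x ^ 2) ^ α := by
  simp [weight, Set.indicator_of_notMem hx]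

theorem pairing_eq_gapFunctional (hα : 0 < α) (ha : 0 < a) (ha1 : a < 1) (p q : ℝ[X]) :
    pairing α a p q = gapFunctional hα a (p * q) := by
  have hc := continuous_jacobi hα (p * q)
  have e1 : Set.EqOn (fun x => p.eval x * q.eval x * weight α a x)
      (fun x => (p * q).eval x * (1 - x ^ 2) ^ α) (Set.uIoc (-1) (-a)) := by
    intro x hx
    rw [Set.uIoc_of_le (by linarith)] at hx
    simp only [eval_mul]
    rw [weight_of_notMem fun h => absurd h.1 (not_lt.2 hx.2)]
  have e2 : Set.EqOn (fun x => p.eval x * q.eval x * weight α a x)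
      (fun x => 0) (Set.Ioo (-a) a) := by
    intro x hx
    simp only [weight_of_mem hx, mul_zero]
  have e3 : Set.EqOn (fun x => p.eval x * q.eval x * weight α a x)
      (fun x => (p * q).eval x * (1 - x ^ 2) ^ α) (Set.uIoc a 1) := by
    intro x hx
    rw [Set.uIoc_of_le (by linarith)] at hx
    simp only [eval_mul]
    rw [weight_of_notMem fun h => absurd h.2 (not_lt.2 hx.1.le)]
  have i1 := (hc.intervalIntegrable (μ := MeasureTheory.volume) (-1) (-a)).congr e1.symm
  have i2 : IntervalIntegrable (fun x => p.eval x * q.eval x * weight α a x)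
      MeasureTheory.volume (-a) a := by
    rw [intervalIntegrable_iff_integrableOn_Ioo_of_le (by linarith)]
    exact (MeasureTheory.integrableOn_zero).congr_fun e2.symm measurableSet_Ioo
  have i3 := (hc.intervalIntegrable (μ := MeasureTheory.volume) a 1).congr e3.symm
  have z : ∫ x in (-a)..a, p.eval x * q.eval x * weight α a x = 0 := by
    rw [integral_of_le (by linarith), MeasureTheory.integral_Ioc_eq_integral_Ioo,
      MeasureTheory.setIntegral_congr_fun measurableSet_Ioo e2]
    simp
  rw [pairing, ← integral_add_adjacent_intervals (i1.trans i2) i3,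
    ← integral_add_adjacent_intervals i1 i2, z, add_zero, gapFunctional_apply,
    integral_congr_ae (Filter.Eventually.of_forall e1),
    integral_congr_ae (Filter.Eventually.of_forall e3)]

theorem gapFunctional_pos (hα : 0 < α) (ha : 0 < a) (ha1 : a < 1) {p : ℝ[X]} (hp : p ≠ 0)
    (h : ∀ x, a ^ 2 ≤ x ^ 2 → 0 ≤ p.eval x) : 0 < gapFunctional hα a p := by
  have h1 : 0 ≤ ∫ x in (-1 : ℝ)..(-a), p.eval x * (1 - x ^ 2) ^ α := by
    refine integral_nonneg (by linarith) fun x hx => mul_nonneg (h x ?_) (Real.rpow_nonneg ?_ _)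
    · nlinarith [hx.1, hx.2]
    · nlinarith [hx.1, hx.2]
  have h2 : 0 < ∫ x in a..(1 : ℝ), p.eval x * (1 - x ^ 2) ^ α := by
    refine integral_pos ha1 (continuous_jacobi hα p).continuousOn
      (fun x hx => mul_nonneg (h x ?_) (Real.rpow_nonneg ?_ _)) ?_
    · nlinarith [hx.1, hx.2]
    · nlinarith [hx.1, hx.2]
    · obtain ⟨c, hc, hc'⟩ := (Set.Ioo_infinite ha1).exists_notMem_finset p.roots.toFinset
      have hc0 : p.eval c ≠ 0 := fun h0 => hc' (by simpa [hp] using h0)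
      refine ⟨c, ⟨hc.1.le, hc.2.le⟩, mul_pos ((h c ?_).lt_of_ne' hc0) (Real.rpow_pos_of_pos ?_ _)⟩
      · nlinarith [hc.1, hc.2]
      · nlinarith [hc.1, hc.2]
  rw [gapFunctional_apply]
  linarith

theorem gapFunctional_comp_neg_X (hα : 0 < α) (a : ℝ) (p : ℝ[X]) :
    gapFunctional hα a (p.comp (-X)) = gapFunctional hα a p := by
  have := integral_comp_neg (a := (-1 : ℝ)) (b := -a) fun x => p.eval x * (1 - x ^ 2) ^ α
  have h2 := integral_comp_neg (a := a) (b := 1) fun x => p.eval x * (1 - x ^ 2) ^ α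
  simp only [neg_sq, neg_neg] at this h2
  simp only [gapFunctional_apply, eval_comp, eval_neg, eval_X, this, h2]
  ring

/-- Integration by parts against the Jacobi weight; the gap contributes the boundary terms. -/
theorem gapFunctional_pearson (hα : 0 < α) (ha : 0 < a) (ha1 : a < 1) (p : ℝ[X]) :
    gapFunctional hα a ((1 - X ^ 2) * derivative p - C (2 * (α + 1)) * (X * p)) =
      (1 - a ^ 2) * (1 - a ^ 2) ^ α * (p.eval (-a) - p.eval a) := by
  set q : ℝ[X] := (1 - X ^ 2) * derivative p - C (2 * (α + 1)) * (X * p) with hq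
  -- The extra power of `1 - x²` in the primitive makes it vanish at `±1`, so only the boundary
  -- terms at `±a` survive.
  have hd (x : ℝ) (hx : 0 ≤ 1 - x ^ 2) :
      HasDerivAt (fun x => p.eval x * (1 - x ^ 2) ^ (α + 1)) (q.eval x * (1 - x ^ 2) ^ α) x := by
    have h1 : HasDerivAt (fun x : ℝ => 1 - x ^ 2) (-(2 * x)) x := by
      simpa using (hasDerivAt_pow 2 x).const_sub 1
    have h2 := (p.hasDerivAt x).mul (h1.rpow_const (p := α + 1) (Or.inr (by linarith)))
    refine h2.congr_deriv ?_
    have h3 : (1 - x ^ 2) ^ (α + 1) = (1 - x ^ 2) ^ α * (1 - x ^ 2) := by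
      rw [Real.rpow_add' hx (by linarith), Real.rpow_one]
    rw [h3, add_sub_cancel_right]
    simp [hq]
    ring
  have hw : (1 - a ^ 2) ^ (α + 1) = (1 - a ^ 2) ^ α * (1 - a ^ 2) := by
    rw [Real.rpow_add' (by nlinarith) (by linarith), Real.rpow_one]
  rw [gapFunctional_apply,
    integral_eq_sub_of_hasDerivAt (f := fun x => p.eval x * (1 - x ^ 2) ^ (α + 1))
      (fun x hx => hd x ?_) ((continuous_jacobi hα q).intervalIntegrable _ _),
    integral_eq_sub_of_hasDerivAt (f := fun x => p.eval x * (1 - x ^ 2) ^ (α + 1))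
      (fun x hx => hd x ?_) ((continuous_jacobi hα q).intervalIntegrable _ _)]
  · have h0 : (0 : ℝ) ^ (α + 1) = 0 := Real.zero_rpow (by linarith)
    simp [h0, hw]
    ring
  · rw [Set.uIcc_of_le (by linarith)] at hx
    nlinarith [hx.1, hx.2]
  · rw [Set.uIcc_of_le (by linarith)] at hx
    nlinarith [hx.1, hx.2]

theorem hasDerivAt_gapFunctional (hα : 0 < α) (a : ℝ) (p : ℝ[X]) :
    HasDerivAt (fun t => gapFunctional hα t p)
      (-((1 - a ^ 2) ^ α * (p.eval a + p.eval (-a)))) a := by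
  have hc := continuous_jacobi hα p
  have h1 := (integral_hasDerivAt_right (hc.intervalIntegrable (-1) (-a))
    (hc.stronglyMeasurableAtFilter _ _) hc.continuousAt).comp a (hasDerivAt_neg a)
  have h2 := integral_hasDerivAt_left (hc.intervalIntegrable a 1)
    (hc.stronglyMeasurableAtFilter _ _) hc.continuousAt
  refine (h1.add h2).congr_deriv ?_
  simp
  ring

/-! ### Orthogonality and expansion in the basis `P_k` -/

theorem P_eq (α : ℝ) (n : ℕ) (a : ℝ) : P α n a = X ^ n - ∑ k ∈ Finset.range n,
    C (pairing α a (X ^ n) (P α k a) / pairing α a (P α k a) (P α k a)) * P α k a := by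
  rw [P, Finset.sum_range]

theorem monic_P_and_degree (α : ℝ) (n : ℕ) (a : ℝ) :
    (P α n a).Monic ∧ (P α n a).degree = n := by
  induction n using Nat.strong_induction_on with
  | _ n ih =>
    have hs : (∑ k ∈ Finset.range n, C (pairing α a (X ^ n) (P α k a) /
        pairing α a (P α k a) (P α k a)) * P α k a).degree < (X ^ n : ℝ[X]).degree := by
      rw [degree_X_pow, ← mem_degreeLT]
      refine Submodule.sum_mem _ fun k hk => ?_
      rw [← smul_eq_C_mul]
      refine Submodule.smul_mem _ _ (mem_degreeLT.2 ?_)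
      rw [(ih k (Finset.mem_range.1 hk)).2]
      exact_mod_cast Finset.mem_range.1 hk
    rw [P_eq]
    exact ⟨(monic_X_pow n).sub_of_left hs,
      (degree_sub_eq_left_of_degree_lt hs).trans (degree_X_pow n)⟩

theorem monic_P (α : ℝ) (n : ℕ) (a : ℝ) : (P α n a).Monic := (monic_P_and_degree α n a).1

theorem degree_P (α : ℝ) (n : ℕ) (a : ℝ) : (P α n a).degree = n := (monic_P_and_degree α n a).2

theorem natDegree_P (α : ℝ) (n : ℕ) (a : ℝ) : (P α n a).natDegree = n :=
  natDegree_eq_of_degree_eq_some (degree_P α n a)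

theorem coeff_P_self (α : ℝ) (n : ℕ) (a : ℝ) : (P α n a).coeff n = 1 := by
  simpa [natDegree_P] using (monic_P α n a).coeff_natDegree

theorem coeff_P_of_lt {n k : ℕ} (α a : ℝ) (hk : n < k) : (P α n a).coeff k = 0 :=
  coeff_eq_zero_of_natDegree_lt (by rwa [natDegree_P])

theorem h_eq (hα : 0 < α) (ha : 0 < a) (ha1 : a < 1) (n : ℕ) :
    h α n a = gapFunctional hα a (P α n a * P α n a) :=
  pairing_eq_gapFunctional hα ha ha1 _ _

theorem h_pos (hα : 0 < α) (ha : 0 < a) (ha1 : a < 1) (n : ℕ) : 0 < h α n a := by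
  rw [h_eq hα ha ha1]
  refine gapFunctional_pos hα ha ha1 (mul_ne_zero (monic_P α n a).ne_zero
    (monic_P α n a).ne_zero) fun x _ => ?_
  rw [eval_mul]
  exact mul_self_nonneg _

theorem gapFunctional_P_mul_P_of_lt (hα : 0 < α) (ha : 0 < a) (ha1 : a < 1) (n : ℕ) :
    ∀ k < n, gapFunctional hα a (P α n a * P α k a) = 0 := by
  induction n using Nat.strong_induction_on with
  | _ n ih =>
    intro k hk
    have ho : ∀ j < n, j ≠ k → gapFunctional hα a (P α j a * P α k a) = 0 := by
      intro j hj hjk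
      rcases lt_or_gt_of_ne hjk with h | h
      · rw [mul_comm]
        exact ih k hk j h
      · exact ih j hj k h
    have hk0 := (h_pos hα ha ha1 k).ne'
    rw [P_eq, sub_mul, map_sub, Finset.sum_mul, map_sum, Finset.sum_eq_single_of_mem k
      (Finset.mem_range.2 hk), mul_assoc, gapFunctional_C_mul, ← h_eq hα ha ha1,
      pairing_eq_gapFunctional hα ha ha1]
    · change _ - _ / h α k a * h α k a = 0
      rw [div_mul_cancel₀ _ hk0, sub_self]
    · intro j hj hjk
      rw [mul_assoc, gapFunctional_C_mul, ho j (Finset.mem_range.1 hj) hjk, mul_zero]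

theorem gapFunctional_P_mul_P (hα : 0 < α) (ha : 0 < a) (ha1 : a < 1) {n k : ℕ} (hk : k ≠ n) :
    gapFunctional hα a (P α k a * P α n a) = 0 := by
  rcases lt_or_gt_of_ne hk with h | h
  · rw [mul_comm]
    exact gapFunctional_P_mul_P_of_lt hα ha ha1 n k h
  · exact gapFunctional_P_mul_P_of_lt hα ha ha1 k n h

/-- Expansion of a polynomial in the orthogonal basis. -/
theorem eq_sum_P (hα : 0 < α) (ha : 0 < a) (ha1 : a < 1) (m : ℕ) (p : ℝ[X])
    (hp : p.degree < m) : p = ∑ k ∈ Finset.range m,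
      C (gapFunctional hα a (p * P α k a) / h α k a) * P α k a := by
  induction m generalizing p with
  | zero => simpa using hp
  | succ m ih =>
    set q := p - C (p.coeff m) * P α m a with hq
    have hpq : p = C (p.coeff m) * P α m a + q := by rw [hq]; ring
    have hqd : q.degree < m := by
      refine (degree_lt_iff_coeff_zero _ _).2 fun i hi => ?_
      rcases hi.eq_or_lt with rfl | hi
      · simp [hq, coeff_P_self]
      · simp [hq, coeff_P_of_lt α a hi, coeff_eq_zero_of_degree_lt
          (hp.trans_le (Nat.cast_le.2 (Nat.succ_le_of_lt hi)))]
    have e := ih q hqd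
    have horth : gapFunctional hα a (q * P α m a) = 0 := by
      rw [e, Finset.sum_mul, map_sum]
      refine Finset.sum_eq_zero fun k hk => ?_
      rw [mul_assoc, gapFunctional_C_mul,
        gapFunctional_P_mul_P hα ha ha1 (Finset.mem_range.1 hk).ne, mul_zero]
    have hm : gapFunctional hα a (p * P α m a) = p.coeff m * h α m a := by
      conv_lhs => rw [hpq]
      rw [add_mul, map_add, horth, mul_assoc, gapFunctional_C_mul, ← h_eq hα ha ha1, add_zero]
    have hlt : ∀ k ∈ Finset.range m, gapFunctional hα a (q * P α k a) =
        gapFunctional hα a (p * P α k a) := by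
      intro k hk
      conv_rhs => rw [hpq]
      rw [add_mul, map_add, mul_assoc, gapFunctional_C_mul,
        gapFunctional_P_mul_P hα ha ha1 (Finset.mem_range.1 hk).ne', mul_zero, zero_add]
    rw [Finset.sum_range_succ, hm, mul_div_cancel_right₀ _ (h_pos hα ha ha1 m).ne',
      ← Finset.sum_congr rfl fun k hk => congrArg (fun c => C (c / h α k a) * P α k a) (hlt k hk),
      ← e, hq]
    ring

theorem gapFunctional_mul_P_eq_zero (hα : 0 < α) (ha : 0 < a) (ha1 : a < 1) {n : ℕ} {p : ℝ[X]}
    (hp : p.degree < n) : gapFunctional hα a (p * P α n a) = 0 := by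
  rw [eq_sum_P hα ha ha1 n p hp, Finset.sum_mul, map_sum]
  refine Finset.sum_eq_zero fun k hk => ?_
  rw [mul_assoc, gapFunctional_C_mul,
    gapFunctional_P_mul_P hα ha ha1 (Finset.mem_range.1 hk).ne, mul_zero]

/-- Subtracting the right multiple of `P_n` lowers the degree below `n`. Connection coefficients can
thus be read off from polynomial coefficients. -/
theorem gapFunctional_mul_P (hα : 0 < α) (ha : 0 < a) (ha1 : a < 1) {n : ℕ} {p : ℝ[X]}
    (hp : p.natDegree ≤ n) : gapFunctional hα a (p * P α n a) = p.coeff n * h α n a := by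
  have hq : (p - C (p.coeff n) * P α n a).degree < n := by
    refine (degree_lt_iff_coeff_zero _ _).2 fun i hi => ?_
    rcases hi.eq_or_lt with rfl | hi
    · simp [coeff_P_self]
    · simp [coeff_P_of_lt α a hi, coeff_eq_zero_of_natDegree_lt (hp.trans_lt hi)]
  have := gapFunctional_mul_P_eq_zero hα ha ha1 hq
  rw [sub_mul, map_sub, mul_assoc, gapFunctional_C_mul, ← h_eq hα ha ha1] at this
  linarith

/-! ### Parity and the value at the edge of the gap -/

theorem coeff_comp_neg_X (p : ℝ[X]) (i : ℕ) :
    (p.comp (-X)).coeff i = (-1) ^ i * p.coeff i := by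
  have : (-X : ℝ[X]) = C (-1) * X := by simp
  rw [this, comp_C_mul_X_coeff, mul_comm]

/-- L is even, so the difference of the two sides, of degree below `n`, is orthogonal to every `P_k`
with `k < n` and hence zero. -/
theorem P_comp_neg_X (hα : 0 < α) (ha : 0 < a) (ha1 : a < 1) (n : ℕ) :
    (P α n a).comp (-X) = C ((-1) ^ n) * P α n a := by
  set p := (P α n a).comp (-X) - C ((-1) ^ n) * P α n a with hp
  have hd : p.degree < n := by
    refine (degree_lt_iff_coeff_zero _ _).2 fun i hi => ?_
    rcases hi.eq_or_lt with rfl | hi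
    · rw [hp, coeff_sub, coeff_C_mul, coeff_comp_neg_X, sub_self]
    · rw [hp, coeff_sub, coeff_C_mul, coeff_comp_neg_X, coeff_P_of_lt α a hi, mul_zero, mul_zero,
        sub_zero]
  have hz : p = 0 := by
    rw [eq_sum_P hα ha ha1 n p hd]
    refine Finset.sum_eq_zero fun k hk => ?_
    have hk' := Finset.mem_range.1 hk
    have hc : ((P α k a).comp (-X)).degree < n := by
      refine (degree_lt_iff_coeff_zero _ _).2 fun i hi => ?_
      rw [coeff_comp_neg_X, coeff_P_of_lt α a (hk'.trans_le hi), mul_zero]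
    have h1 := gapFunctional_comp_neg_X hα a ((P α k a).comp (-X) * P α n a)
    rw [mul_comp, comp_assoc, neg_comp, X_comp, neg_neg, comp_X,
      gapFunctional_mul_P_eq_zero hα ha ha1 hc] at h1
    have h2 : gapFunctional hα a (p * P α k a) = 0 := by
      rw [hp, sub_mul, map_sub, mul_assoc, gapFunctional_C_mul,
        gapFunctional_P_mul_P hα ha ha1 hk'.ne', mul_comm _ (P α k a), h1]
      simp
    rw [h2]
    simp
  rw [← sub_eq_zero, ← hz]

theorem eval_neg_P (hα : 0 < α) (ha : 0 < a) (ha1 : a < 1) (n : ℕ) (x : ℝ) :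
    (P α n a).eval (-x) = (-1) ^ n * (P α n a).eval x := by
  have := congrArg (eval x) (P_comp_neg_X hα ha ha1 n)
  simpa [eval_comp] using this

theorem coeff_P_succ (hα : 0 < α) (ha : 0 < a) (ha1 : a < 1) (n : ℕ) :
    (P α (n + 1) a).coeff n = 0 := by
  have := congrArg (fun p => coeff p n) (P_comp_neg_X hα ha ha1 (n + 1))
  simp only [coeff_comp_neg_X, coeff_C_mul, pow_succ] at this
  have h1 : ((-1 : ℝ) ^ n) ≠ 0 := by positivity
  have h2 : (-1 : ℝ) ^ n * (P α (n + 1) a).coeff n = 0 := by linarith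
  exact (mul_eq_zero.1 h2).resolve_left h1

/-- A zero at `a` forces one at `-a`, so `P_n = (x² - a²) s` with `deg s < n`. Then `L(s P_n) = 0`,
although `(x² - a²) s²` is nonnegative off the gap. This permits division by `R_n`. -/
theorem eval_P_ne_zero (hα : 0 < α) (ha : 0 < a) (ha1 : a < 1) (n : ℕ) :
    (P α n a).eval a ≠ 0 := by
  intro h0
  have h1 : (P α n a).eval (-a) = 0 := by rw [eval_neg_P hα ha ha1, h0, mul_zero]
  obtain ⟨q, hq⟩ := dvd_iff_isRoot.2 h0
  have h2 : q.eval (-a) = 0 := by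
    rw [hq, eval_mul] at h1
    refine (mul_eq_zero.1 h1).resolve_left ?_
    simp only [eval_sub, eval_X, eval_C]
    linarith
  obtain ⟨s, hs⟩ := dvd_iff_isRoot.2 h2
  have hP : P α n a = (X ^ 2 - C (a ^ 2)) * s := by
    rw [hq, hs]
    simp only [map_neg, map_pow]
    ring
  have hs0 : s ≠ 0 := by
    rintro rfl
    exact (monic_P α n a).ne_zero (by rw [hP, mul_zero])
  have hm : (X ^ 2 - C (a ^ 2) : ℝ[X]).Monic := monic_X_pow_sub_C _ two_ne_zero
  have hd : s.degree < n := by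
    rw [← degree_P α n a, hP, degree_mul, degree_X_pow_sub_C two_pos, degree_eq_natDegree hs0]
    norm_cast
    omega
  have h3 := gapFunctional_mul_P_eq_zero hα ha ha1 hd
  rw [hP] at h3
  refine (gapFunctional_pos hα ha ha1 (mul_ne_zero hs0 (mul_ne_zero hm.ne_zero hs0))
    fun x hx => ?_).ne' h3
  simp only [eval_mul, eval_sub, eval_pow, eval_X, eval_C]
  nlinarith [mul_nonneg (sub_nonneg.2 hx) (mul_self_nonneg (s.eval x))]

theorem R_pos (hα : 0 < α) (ha : 0 < a) (ha1 : a < 1) (n : ℕ) : 0 < R α n a := by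
  have := eval_P_ne_zero hα ha ha1 n
  have := h_pos hα ha ha1 n
  have : 0 < (1 - a ^ 2) ^ α := Real.rpow_pos_of_pos (by nlinarith) _
  rw [R]
  positivity

/-! ### Three-term recurrence and its consequences at `a` -/

theorem gapFunctional_X_mul_P (hα : 0 < α) (ha : 0 < a) (ha1 : a < 1) {n k : ℕ} (hk : k < n) :
    gapFunctional hα a (X * P α k a * P α n a) = if k + 1 = n then h α n a else 0 := by
  have hd : (X * P α k a).natDegree ≤ n := by
    refine natDegree_le_iff_coeff_eq_zero.2 fun i hi => ?_
    obtain ⟨i, rfl⟩ := Nat.exists_eq_succ_of_ne_zero (show i ≠ 0 by omega)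
    rw [coeff_X_mul, coeff_P_of_lt α a (by omega)]
  rw [gapFunctional_mul_P hα ha ha1 hd]
  obtain ⟨n, rfl⟩ := Nat.exists_eq_succ_of_ne_zero (show n ≠ 0 by omega)
  rw [coeff_X_mul]
  split_ifs with h
  · obtain rfl : k = n := by omega
    rw [coeff_P_self, one_mul]
  · rw [coeff_P_of_lt α a (by omega), zero_mul]

theorem X_mul_P_zero (hα : 0 < α) (ha : 0 < a) (ha1 : a < 1) : X * P α 0 a = P α 1 a := by
  ext i
  rcases i with _ | _ | i
  · simpa using (coeff_P_succ hα ha ha1 0).symm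
  · simp [coeff_P_self]
  · rw [coeff_X_mul, coeff_P_of_lt α a (by omega), coeff_P_of_lt α a (by omega)]

/-- The recurrence, with its coefficient given by the norms. -/
theorem X_mul_P_succ_norms (hα : 0 < α) (ha : 0 < a) (ha1 : a < 1) (n : ℕ) :
    X * P α (n + 1) a = P α (n + 2) a + C (h α (n + 1) a / h α n a) * P α n a := by
  -- The leading terms cancel, and parity removes the coefficient of `x^(n+1)`.
  have hd : (X * P α (n + 1) a - P α (n + 2) a).degree < ((n + 1 : ℕ) : WithBot ℕ) := by
    refine (degree_lt_iff_coeff_zero _ _).2 fun i hi => ?_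
    obtain ⟨i, rfl⟩ := Nat.exists_eq_succ_of_ne_zero (show i ≠ 0 by omega)
    rw [coeff_sub, coeff_X_mul]
    rcases (show n ≤ i by omega).eq_or_lt with rfl | hi
    · rw [coeff_P_succ hα ha ha1, Nat.succ_eq_add_one, coeff_P_succ hα ha ha1, sub_zero]
    rcases (show n + 1 ≤ i by omega).eq_or_lt with rfl | hi
    · simp [coeff_P_self]
    · rw [coeff_P_of_lt α a hi, coeff_P_of_lt α a (by omega), sub_zero]
  rw [← sub_eq_iff_eq_add', eq_sum_P hα ha ha1 (n + 1) _ hd]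
  have hc : ∀ k < n + 1, gapFunctional hα a ((X * P α (n + 1) a - P α (n + 2) a) * P α k a) =
      if k + 1 = n + 1 then h α (n + 1) a else 0 := by
    intro k hk
    rw [sub_mul, map_sub, gapFunctional_P_mul_P hα ha ha1 (by omega), sub_zero,
      ← gapFunctional_X_mul_P hα ha ha1 hk]
    congr 1
    ring
  rw [Finset.sum_range_succ, hc n (by omega), if_pos rfl, Finset.sum_eq_zero, zero_add]
  intro k hk
  have := Finset.mem_range.1 hk
  rw [hc k (by omega), if_neg (by omega)]
  simp

theorem β_succ (hα : 0 < α) (ha : 0 < a) (ha1 : a < 1) (n : ℕ) :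
    β α (n + 1) a = h α (n + 1) a / h α n a := by
  rw [β, X_mul_P_succ_norms hα ha ha1, add_sub_cancel_left, coeff_C_mul, coeff_P_self, mul_one]

theorem X_mul_P_succ (hα : 0 < α) (ha : 0 < a) (ha1 : a < 1) (n : ℕ) :
    X * P α (n + 1) a = P α (n + 2) a + C (β α (n + 1) a) * P α n a := by
  rw [β_succ hα ha ha1, X_mul_P_succ_norms hα ha ha1]

theorem mul_R (hα : 0 < α) (ha : 0 < a) (ha1 : a < 1) (n : ℕ) :
    a * R α n a = r α (n + 1) a + r α n a := by
  have hn := (h_pos hα ha ha1 n).ne'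
  rcases n with _ | n
  · have e := congrArg (eval a) (X_mul_P_zero hα ha ha1)
    rw [eval_mul, eval_X] at e
    rw [R, r, r, ← e]
    ring
  · have hn' := (h_pos hα ha ha1 n).ne'
    have e := congrArg (eval a) (X_mul_P_succ_norms hα ha ha1 n)
    simp only [eval_mul, eval_X, eval_add, eval_C] at e
    have e' : eval a (P α (n + 2) a) = a * eval a (P α (n + 1) a) -
      h α (n + 1) a / h α n a * eval a (P α n a) := by linarith
    rw [R, r, r, e']
    field_simp
    ring

theorem β_mul_R_mul_R (hα : 0 < α) (ha : 0 < a) (ha1 : a < 1) (n : ℕ) :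
    β α (n + 1) a * R α (n + 1) a * R α n a = r α (n + 1) a ^ 2 := by
  have hn := (h_pos hα ha ha1 n).ne'
  have hn' := (h_pos hα ha ha1 (n + 1)).ne'
  rw [β_succ hα ha ha1, R, R, r]
  field_simp

/-- The alternating sum telescopes by `mul_R`, starting from `r_0 = 0`. -/
theorem sum_neg_one_pow_mul_R (hα : 0 < α) (ha : 0 < a) (ha1 : a < 1) (n : ℕ) :
    ∑ k ∈ Finset.range n, (-1) ^ (n + k) * R α k a = -(r α n a / a) := by
  induction n with
  | zero => simp [r]
  | succ n ih =>
    have e : ∀ k, (-1 : ℝ) ^ (n + 1 + k) * R α k a = -((-1) ^ (n + k) * R α k a) := by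
      intro k
      ring
    have h1 : R α n a = (r α (n + 1) a + r α n a) / a := by
      rw [← mul_R hα ha ha1]
      field_simp
    rw [Finset.sum_range_succ, Finset.sum_congr rfl fun k _ => e k, Finset.sum_neg_distrib, ih, e,
      ← two_mul, pow_mul, neg_one_sq, one_pow, h1]
    ring

/-! ### Structure relation and difference equations in `n` -/

theorem coeff_X_mul_derivative (p : ℝ[X]) (i : ℕ) :
    (X * derivative p).coeff i = i * p.coeff i := by
  rcases i with _ | i
  · simp
  · rw [coeff_X_mul, coeff_derivative]
    push_cast
    ring

/-- The part of `(1 - x²) P_n'` of degree less than `n`. -/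
def structurePoly (α : ℝ) (n : ℕ) (a : ℝ) : ℝ[X] :=
  (1 - X ^ 2) * derivative (P α n a) + C (n : ℝ) * (X * P α n a)

theorem coeff_structurePoly (α : ℝ) (n : ℕ) (a : ℝ) (i : ℕ) :
    (structurePoly α n a).coeff i = (i + 1) * (P α n a).coeff (i + 1) +
      (n + 1 - i) * (X * P α n a).coeff i := by
  have e : structurePoly α n a = derivative (P α n a) - X * (X * derivative (P α n a)) +
      C (n : ℝ) * (X * P α n a) := by
    rw [structurePoly]
    ring
  rw [e, coeff_add, coeff_sub, coeff_C_mul, coeff_derivative]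
  rcases i with _ | i
  · simp
  · rw [coeff_X_mul, coeff_X_mul_derivative, coeff_X_mul]
    push_cast
    ring

theorem degree_structurePoly_lt (hα : 0 < α) (ha : 0 < a) (ha1 : a < 1) (n : ℕ) :
    (structurePoly α n a).degree < n := by
  refine (degree_lt_iff_coeff_zero _ _).2 fun i hi => ?_
  rw [coeff_structurePoly, coeff_P_of_lt α a (by omega)]
  rcases i with _ | i
  · simp
  rw [coeff_X_mul]
  rcases hi.eq_or_lt with rfl | hi
  · rw [coeff_P_succ hα ha ha1]
    ring
  rcases (show n ≤ i by omega).eq_or_lt with rfl | hi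
  · push_cast
    ring
  · rw [coeff_P_of_lt α a hi]
    ring

theorem gapFunctional_structurePoly_mul_P (hα : 0 < α) (ha : 0 < a) (ha1 : a < 1) {n k : ℕ}
    (hk : k < n) : gapFunctional hα a (structurePoly α n a * P α k a) =
      (if k + 1 = n then (2 * n + 2 * α + 1) * h α n a else 0) +
      (1 - a ^ 2) * (1 - a ^ 2) ^ α * ((P α n a).eval a * (P α k a).eval a) *
        ((-1) ^ (n + k) - 1) := by
  -- Symmetrizing in `n` and `k` produces a Pearson term; `structurePoly α k a` has degree below `k
  -- < n`, so its product with `P_n` is annihilated by L.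
  have e : structurePoly α n a * P α k a =
      ((1 - X ^ 2) * derivative (P α n a * P α k a) -
        C (2 * (α + 1)) * (X * (P α n a * P α k a))) -
      structurePoly α k a * P α n a +
      C (2 * (α + 1) + n + k) * (X * P α k a * P α n a) := by
    simp only [structurePoly, derivative_mul, map_add]
    ring
  rw [e, map_add, map_sub, gapFunctional_pearson hα ha ha1, gapFunctional_C_mul,
    gapFunctional_X_mul_P hα ha ha1 hk, gapFunctional_mul_P_eq_zero hα ha ha1
      ((degree_structurePoly_lt hα ha ha1 k).trans (Nat.cast_lt.2 hk)),
    eval_mul, eval_mul, eval_neg_P hα ha ha1, eval_neg_P hα ha ha1]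
  split_ifs with hkn
  · subst hkn
    push_cast
    ring
  · ring

theorem coeff_structurePoly_succ (hα : 0 < α) (ha : 0 < a) (ha1 : a < 1) (n : ℕ) :
    (structurePoly α (n + 1) a).coeff n =
      (2 * n + 2 * α + 3) * β α (n + 1) a - (1 - a ^ 2) * r α (n + 1) a := by
  have hn := (h_pos hα ha ha1 n).ne'
  have hd : (structurePoly α (n + 1) a).natDegree ≤ n :=
    natDegree_le_iff_coeff_eq_zero.2
      ((degree_lt_iff_coeff_zero _ _).1 (degree_structurePoly_lt hα ha ha1 (n + 1)))
  have e := gapFunctional_mul_P hα ha ha1 hd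
  rw [gapFunctional_structurePoly_mul_P hα ha ha1 n.lt_succ_self, if_pos rfl] at e
  rw [← mul_right_cancel_iff_of_pos (h_pos hα ha ha1 n), ← e, β_succ hα ha ha1, r]
  have : (-1 : ℝ) ^ (n + 1 + n) = -1 := Odd.neg_one_pow ⟨n, by ring⟩
  rw [this]
  field_simp
  push_cast
  ring

/-- The top coefficient of the structure polynomial is computed twice: from monomials and from
orthogonality. -/
theorem sub_leading_coeff (hα : 0 < α) (ha : 0 < a) (ha1 : a < 1) (n : ℕ) :
    (n : ℝ) + 1 + 2 * (X * P α (n + 1) a).coeff n =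
      (2 * n + 2 * α + 3) * β α (n + 1) a - (1 - a ^ 2) * r α (n + 1) a := by
  rw [← coeff_structurePoly_succ hα ha ha1, coeff_structurePoly, coeff_P_self]
  push_cast
  ring

/-- The linear difference equation satisfied by `β_n` and `r_n`. -/
theorem linear_relation (hα : 0 < α) (ha : 0 < a) (ha1 : a < 1) (n : ℕ) :
    (2 * n + 2 * α + 3) * β α (n + 1) a - (2 * n + 2 * α - 1) * β α n a =
      1 + (1 - a ^ 2) * (r α (n + 1) a - r α n a) := by
  rcases n with _ | n
  · have h0 := sub_leading_coeff hα ha ha1 0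
    simp only [mul_coeff_zero, coeff_X_zero, zero_mul] at h0
    simp only [β.eq_1, r.eq_1]
    push_cast at h0 ⊢
    linarith
  · have h0 := sub_leading_coeff hα ha ha1 n
    have h1 := sub_leading_coeff hα ha ha1 (n + 1)
    rw [coeff_X_mul] at h1
    -- The recurrence links consecutive subleading coefficients, which cancel in the difference of
    -- `h0` and `h1`.
    rw [X_mul_P_succ hα ha ha1, coeff_add, coeff_C_mul, coeff_P_self] at h0
    push_cast at h1 ⊢
    linarith

/-- The quadratic first integral that determines `β_n` from `R_n` and `r_n`. -/
theorem quadratic_relation_succ (hα : 0 < α) (ha : 0 < a) (ha1 : a < 1) (n : ℕ) :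
    β α (n + 1) a * ((2 * n + 2 * α + 3) * (2 * n + 2 * α + 1) +
        a * (2 * n + 2 * α + 3) * R α n a + a * (2 * n + 2 * α + 1) * R α (n + 1) a) =
      (1 - a ^ 2) * r α (n + 1) a ^ 2 + 2 * (n + 1 + α) * r α (n + 1) a +
        (n + 1) * (n + 1 + 2 * α) := by
  have hb (m : ℕ) := β_mul_R_mul_R hα ha ha1 m
  have hb' (m : ℕ) : β α (m + 1) a * R α (m + 1) a = r α (m + 1) a ^ 2 / R α m a := by
    rw [← hb, mul_div_cancel_right₀ _ (R_pos hα ha ha1 m).ne']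
  have hq (m : ℕ) : r α (m + 1) a ^ 2 / R α m a - r α m a ^ 2 / R α m a =
      a * (r α (m + 1) a - r α m a) := by
    rw [← sub_div, div_eq_iff (R_pos hα ha ha1 m).ne']
    linear_combination (-(r α (m + 1) a - r α m a)) * mul_R hα ha ha1 m
  induction n with
  | zero =>
    have hl := linear_relation hα ha ha1 0
    have hR := mul_R hα ha ha1 0
    have hb0 := hb' 0
    have hq0 := hq 0
    simp only [r.eq_1, β.eq_1, Nat.cast_zero, zero_add] at *
    rw [zero_pow two_ne_zero, zero_div] at hq0
    linear_combination (2 * α + 1 + a * R α 0 a) * hl + a * (2 * α + 1) * hb0 +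
      a * (2 * α + 1) * hq0 + (1 + (1 - a ^ 2) * r α 1 a) * hR
  | succ n ih =>
    have hl := linear_relation hα ha ha1 (n + 1)
    have hR := mul_R hα ha ha1 (n + 1)
    have hb3 : β α (n + 1) a * R α n a = r α (n + 1) a ^ 2 / R α (n + 1) a := by
      rw [← hb, mul_right_comm, mul_div_cancel_right₀ _ (R_pos hα ha ha1 (n + 1)).ne']
    push_cast at *
    -- The factor of `hl` is the integrating factor `2m + 2α + 1 + a R_m` at `m = n + 1`.
    linear_combination ih + (2 * n + 2 * α + 3 + a * R α (n + 1) a) * hl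
      + a * (2 * n + 2 * α + 3) * (hb' (n + 1) - hb3) +
      a * (2 * n + 2 * α + 3) * hq (n + 1) +
      (1 + (1 - a ^ 2) * (r α (n + 2) a - r α (n + 1) a)) * hR

theorem quadratic_relation (hα : 0 < α) (ha : 0 < a) (ha1 : a < 1) (n : ℕ) :
    (2 * n + 2 * α - 1) * β α n a * R α n a * (a * R α n a + 2 * n + 2 * α + 1) =
      ((1 - a ^ 2) * r α n a ^ 2 + 2 * (n + α) * r α n a + n ^ 2 + 2 * n * α) * R α n a -
        (2 * n + 2 * α + 1) * a * r α n a ^ 2 := by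
  rcases n with _ | n
  · simp [β, r]
  · have e := quadratic_relation_succ hα ha ha1 n
    have hb := β_mul_R_mul_R hα ha ha1 n
    push_cast
    linear_combination R α (n + 1) a * e - a * (2 * n + 2 * α + 3) * hb

theorem one_sub_sq_mul_eval_derivative_P (hα : 0 < α) (ha : 0 < a) (ha1 : a < 1) (n : ℕ) :
    (1 - a ^ 2) * (derivative (P α n a)).eval a = (P α n a).eval a *
      (-(n * a) + (2 * n + 2 * α + 1) * (r α n a / R α n a) +
        (1 - a ^ 2) * ∑ k ∈ Finset.range n, ((-1) ^ (n + k) - 1) * R α k a / 2) := by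
  have hy := eval_P_ne_zero hα ha ha1 n
  have hW : (1 - a ^ 2) ^ α ≠ 0 := (Real.rpow_pos_of_pos (by nlinarith) _).ne'
  have hD := congrArg (eval a) (eq_sum_P hα ha ha1 n _ (degree_structurePoly_lt hα ha ha1 n))
  have hs : ∀ k ∈ Finset.range n,
      (C (gapFunctional hα a (structurePoly α n a * P α k a) / h α k a) * P α k a).eval a =
      (if k + 1 = n then (P α n a).eval a * ((2 * n + 2 * α + 1) * (r α n a / R α n a)) else 0) +
      (P α n a).eval a * ((1 - a ^ 2) * (((-1) ^ (n + k) - 1) * R α k a / 2)) := by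
    intro k hk
    have hk' := Finset.mem_range.1 hk
    have hh := (h_pos hα ha ha1 k).ne'
    have hh' := (h_pos hα ha ha1 n).ne'
    rw [gapFunctional_structurePoly_mul_P hα ha ha1 hk', eval_mul, eval_C, R.eq_1 α k a]
    split_ifs with hkn
    · subst hkn
      rw [R.eq_1 α (k + 1) a, r]
      field_simp
    · field_simp
      ring
  rw [eval_finsetSum, Finset.sum_congr rfl hs, Finset.sum_add_distrib, ← Finset.mul_sum,
    ← Finset.mul_sum] at hD
  have hone : (∑ k ∈ Finset.range n, if k + 1 = n then
      (P α n a).eval a * ((2 * n + 2 * α + 1) * (r α n a / R α n a)) else 0) =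
      (P α n a).eval a * ((2 * n + 2 * α + 1) * (r α n a / R α n a)) := by
    rcases n with _ | n
    · simp [r]
    · simp
  rw [hone] at hD
  simp only [structurePoly, eval_add, eval_mul, eval_sub, eval_one, eval_pow, eval_X,
    eval_C] at hD
  linear_combination hD

/-! ### Differentiation of polynomial families -/

/-- A family of polynomials of bounded degree is differentiable at `a`, coefficient by
coefficient, with derivative `f'`. -/
def HasCoeffDerivAt (f : ℝ → ℝ[X]) (f' : ℝ[X]) (a : ℝ) : Prop :=
  (∃ N, (∀ t, (f t).natDegree ≤ N) ∧ f'.natDegree ≤ N) ∧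
    ∀ i, HasDerivAt (fun t => (f t).coeff i) (f'.coeff i) a

namespace HasCoeffDerivAt

variable {f g : ℝ → ℝ[X]} {f' g' : ℝ[X]}

theorem const (p : ℝ[X]) (a : ℝ) : HasCoeffDerivAt (fun _ => p) 0 a :=
  ⟨⟨p.natDegree, fun _ => le_rfl, by simp⟩, fun i => by simpa using hasDerivAt_const a _⟩

theorem C {c : ℝ → ℝ} {c' : ℝ} (hc : HasDerivAt c c' a) :
    HasCoeffDerivAt (fun t => C (c t)) (C c') a := by
  refine ⟨⟨0, fun _ => by simp, by simp⟩, fun i => ?_⟩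
  simp only [coeff_C]
  split_ifs
  · exact hc
  · exact hasDerivAt_const a _

theorem sub (hf : HasCoeffDerivAt f f' a) (hg : HasCoeffDerivAt g g' a) :
    HasCoeffDerivAt (fun t => f t - g t) (f' - g') a := by
  obtain ⟨⟨N, hN, hN'⟩, hf⟩ := hf
  obtain ⟨⟨M, hM, hM'⟩, hg⟩ := hg
  refine ⟨⟨max N M, fun t => (natDegree_sub_le _ _).trans (max_le_max (hN t) (hM t)),
    (natDegree_sub_le _ _).trans (max_le_max hN' hM')⟩, fun i => ?_⟩
  simp only [coeff_sub]
  exact (hf i).sub (hg i)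

theorem add (hf : HasCoeffDerivAt f f' a) (hg : HasCoeffDerivAt g g' a) :
    HasCoeffDerivAt (fun t => f t + g t) (f' + g') a := by
  obtain ⟨⟨N, hN, hN'⟩, hf⟩ := hf
  obtain ⟨⟨M, hM, hM'⟩, hg⟩ := hg
  refine ⟨⟨max N M, fun t => (natDegree_add_le _ _).trans (max_le_max (hN t) (hM t)),
    (natDegree_add_le _ _).trans (max_le_max hN' hM')⟩, fun i => ?_⟩
  simp only [coeff_add]
  exact (hf i).add (hg i)

theorem mul (hf : HasCoeffDerivAt f f' a) (hg : HasCoeffDerivAt g g' a) :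
    HasCoeffDerivAt (fun t => f t * g t) (f' * g a + f a * g') a := by
  obtain ⟨⟨N, hN, hN'⟩, hf⟩ := hf
  obtain ⟨⟨M, hM, hM'⟩, hg⟩ := hg
  refine ⟨⟨N + M, fun t => natDegree_mul_le.trans (add_le_add (hN t) (hM t)),
    natDegree_add_le_of_degree_le (natDegree_mul_le.trans (add_le_add hN' (hM a)))
      (natDegree_mul_le.trans (add_le_add (hN a) hM'))⟩, fun i => ?_⟩
  simp only [coeff_mul, coeff_add, ← Finset.sum_add_distrib]
  exact HasDerivAt.fun_sum fun x _ => (hf x.1).mul (hg x.2)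

theorem sum {f : ℕ → ℝ → ℝ[X]} {f' : ℕ → ℝ[X]} {n : ℕ}
    (hf : ∀ k < n, HasCoeffDerivAt (f k) (f' k) a) :
    HasCoeffDerivAt (fun t => ∑ k ∈ Finset.range n, f k t) (∑ k ∈ Finset.range n, f' k) a := by
  induction n with
  | zero => simpa using const 0 a
  | succ n ih =>
    simp only [Finset.sum_range_succ]
    exact (ih fun k hk => hf k (hk.trans n.lt_succ_self)).add (hf n n.lt_succ_self)

theorem hasDerivAt_eval_self (hf : HasCoeffDerivAt f f' a) :
    HasDerivAt (fun t => (f t).eval t) (f'.eval a + (derivative (f a)).eval a) a := by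
  obtain ⟨⟨N, hN, hN'⟩, hf⟩ := hf
  have e : ∀ t x, (f t).eval x = ∑ i ∈ Finset.range (N + 1), (f t).coeff i * x ^ i := fun t x =>
    eval_eq_sum_range' (Nat.lt_succ_of_le (hN t)) x
  have h1 : HasDerivAt (fun x => (f a).eval x)
      (∑ i ∈ Finset.range (N + 1), (f a).coeff i * (i * a ^ (i - 1))) a := by
    simp only [e]
    exact HasDerivAt.fun_sum fun i _ => (hasDerivAt_pow i a).const_mul _
  -- Uniqueness of derivatives puts the `x`-derivative in the form of a coefficient sum over the
  -- uniform range.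
  rw [((f a).hasDerivAt a).unique h1, eval_eq_sum_range' (Nat.lt_succ_of_le hN') a,
    ← Finset.sum_add_distrib]
  simp only [e]
  exact HasDerivAt.fun_sum fun i _ => (hf i).mul (hasDerivAt_pow i a)

theorem hasDerivAt_gapFunctional (hα : 0 < α) (hf : HasCoeffDerivAt f f' a) :
    HasDerivAt (fun t => gapFunctional hα t (f t)) (gapFunctional hα a f' -
      (1 - a ^ 2) ^ α * ((f a).eval a + (f a).eval (-a))) a := by
  obtain ⟨⟨N, hN, hN'⟩, hf⟩ := hf
  have e : ∀ t s, gapFunctional hα s (f t) = ∑ i ∈ Finset.range (N + 1),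
      (f t).coeff i * gapFunctional hα s (X ^ i) := fun t s => by
    conv_lhs => rw [as_sum_range_C_mul_X_pow' (f t) (Nat.lt_succ_of_le (hN t)), map_sum]
    simp only [gapFunctional_C_mul]
  have h1 : HasDerivAt (fun s => gapFunctional hα s (f a)) (∑ i ∈ Finset.range (N + 1),
      (f a).coeff i * (-((1 - a ^ 2) ^ α * ((X ^ i : ℝ[X]).eval a +
        (X ^ i : ℝ[X]).eval (-a))))) a := by
    simp only [e]
    exact HasDerivAt.fun_sum fun i _ => (JacobiGap.hasDerivAt_gapFunctional hα a _).const_mul _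
  have h2 : gapFunctional hα a f' = ∑ i ∈ Finset.range (N + 1),
      f'.coeff i * gapFunctional hα a (X ^ i) := by
    conv_lhs => rw [as_sum_range_C_mul_X_pow' f' (Nat.lt_succ_of_le hN'), map_sum]
    simp only [gapFunctional_C_mul]
  rw [sub_eq_add_neg, (JacobiGap.hasDerivAt_gapFunctional hα a (f a)).unique h1, h2,
    ← Finset.sum_add_distrib]
  simp only [e]
  exact HasDerivAt.fun_sum fun i _ => (hf i).mul (JacobiGap.hasDerivAt_gapFunctional hα a _)

theorem hasDerivAt_pairing (hα : 0 < α) (ha : 0 < a) (ha1 : a < 1) (hf : HasCoeffDerivAt f f' a)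
    (hg : HasCoeffDerivAt g g' a) : HasDerivAt (fun t => pairing α t (f t) (g t))
      (gapFunctional hα a (f' * g a) + gapFunctional hα a (f a * g') - (1 - a ^ 2) ^ α *
        ((f a).eval a * (g a).eval a + (f a).eval (-a) * (g a).eval (-a))) a := by
  have h1 := (hf.mul hg).hasDerivAt_gapFunctional hα
  simp only [map_add, eval_mul] at h1
  refine h1.congr_of_eventuallyEq ?_
  filter_upwards [Ioo_mem_nhds ha ha1] with t ht
  exact pairing_eq_gapFunctional hα ht.1 ht.2 _ _

end HasCoeffDerivAt

/-! ### Dependence on the gap endpoint -/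

theorem exists_hasCoeffDerivAt_P (hα : 0 < α) (ha : 0 < a) (ha1 : a < 1) (n : ℕ) :
    ∃ Q, HasCoeffDerivAt (P α n) Q a := by
  induction n using Nat.strong_induction_on with
  | _ n ih =>
    choose! Q hQ using ih
    have hP : P α n = fun t => X ^ n - ∑ k ∈ Finset.range n,
        C (pairing α t (X ^ n) (P α k t) / pairing α t (P α k t) (P α k t)) * P α k t :=
      funext fun t => P_eq α n t
    rw [hP]
    exact ⟨_, (HasCoeffDerivAt.const _ a).sub (HasCoeffDerivAt.sum fun k hk =>
      (HasCoeffDerivAt.C (((HasCoeffDerivAt.const _ a).hasDerivAt_pairing hα ha ha1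
        (hQ k hk)).fun_div ((hQ k hk).hasDerivAt_pairing hα ha ha1 (hQ k hk))
          (h_pos hα ha ha1 k).ne')).mul (hQ k hk))⟩

/-- The derivative of `P_n(·,a)` with respect to the endpoint `a` of the gap. -/
def gapDeriv (hα : 0 < α) (ha : 0 < a) (ha1 : a < 1) (n : ℕ) : ℝ[X] :=
  (exists_hasCoeffDerivAt_P hα ha ha1 n).choose

theorem hasCoeffDerivAt_P (hα : 0 < α) (ha : 0 < a) (ha1 : a < 1) (n : ℕ) :
    HasCoeffDerivAt (P α n) (gapDeriv hα ha ha1 n) a :=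
  (exists_hasCoeffDerivAt_P hα ha ha1 n).choose_spec

theorem degree_gapDeriv_lt (hα : 0 < α) (ha : 0 < a) (ha1 : a < 1) (n : ℕ) :
    (gapDeriv hα ha ha1 n).degree < n := by
  refine (degree_lt_iff_coeff_zero _ _).2 fun i hi => ?_
  refine ((hasCoeffDerivAt_P hα ha ha1 n).2 i).unique ?_
  rcases hi.eq_or_lt with rfl | hi
  · simpa only [coeff_P_self] using hasDerivAt_const a (1 : ℝ)
  · simpa only [coeff_P_of_lt α _ hi] using hasDerivAt_const a (0 : ℝ)

/-- Differentiate `L(P_n P_k) = 0` in `a`: the term with `∂_a P_k` vanishes by degree, and the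
moving endpoints give the right side. -/
theorem gapFunctional_gapDeriv_mul_P (hα : 0 < α) (ha : 0 < a) (ha1 : a < 1) {n k : ℕ}
    (hk : k < n) : gapFunctional hα a (gapDeriv hα ha ha1 n * P α k a) =
      (1 - a ^ 2) ^ α * ((P α n a).eval a * (P α k a).eval a) * (1 + (-1) ^ (n + k)) := by
  have h1 := (hasCoeffDerivAt_P hα ha ha1 n).hasDerivAt_pairing hα ha ha1
    (hasCoeffDerivAt_P hα ha ha1 k)
  have h2 : HasDerivAt (fun t => pairing α t (P α n t) (P α k t)) 0 a := by
    refine (hasDerivAt_const a (0 : ℝ)).congr_of_eventuallyEq ?_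
    filter_upwards [Ioo_mem_nhds ha ha1] with t ht
    rw [pairing_eq_gapFunctional hα ht.1 ht.2, gapFunctional_P_mul_P hα ht.1 ht.2 hk.ne']
  have h3 := h1.unique h2
  rw [mul_comm (P α n a), gapFunctional_mul_P_eq_zero hα ha ha1
    ((degree_gapDeriv_lt hα ha ha1 k).trans (Nat.cast_lt.2 hk)), eval_neg_P hα ha ha1,
    eval_neg_P hα ha ha1] at h3
  linear_combination h3

/-- The norms satisfy `h_n' = -R_n h_n`. -/
theorem hasDerivAt_h (hα : 0 < α) (ha : 0 < a) (ha1 : a < 1) (n : ℕ) :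
    HasDerivAt (fun t => h α n t) (-(R α n a * h α n a)) a := by
  have h1 := (hasCoeffDerivAt_P hα ha ha1 n).hasDerivAt_pairing hα ha ha1
    (hasCoeffDerivAt_P hα ha ha1 n)
  refine h1.congr_deriv ?_
  have hh := (h_pos hα ha ha1 n).ne'
  have hs : ((-1 : ℝ) ^ n) ^ 2 = 1 := by rw [← pow_mul, mul_comm, pow_mul, neg_one_sq, one_pow]
  rw [mul_comm (P α n a), gapFunctional_mul_P_eq_zero hα ha ha1 (degree_gapDeriv_lt hα ha ha1 n),
    eval_neg_P hα ha ha1, R, div_mul_cancel₀ _ hh]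
  linear_combination -((1 - a ^ 2) ^ α * (P α n a).eval a ^ 2) * hs

theorem eval_gapDeriv (hα : 0 < α) (ha : 0 < a) (ha1 : a < 1) (n : ℕ) :
    (gapDeriv hα ha ha1 n).eval a = (P α n a).eval a *
      ∑ k ∈ Finset.range n, (1 + (-1) ^ (n + k)) * R α k a / 2 := by
  rw [eq_sum_P hα ha ha1 n _ (degree_gapDeriv_lt hα ha ha1 n), eval_finsetSum, Finset.mul_sum]
  refine Finset.sum_congr rfl fun k hk => ?_
  rw [gapFunctional_gapDeriv_mul_P hα ha ha1 (Finset.mem_range.1 hk), eval_mul, eval_C, R]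
  ring

/-- The logarithmic derivative of `a ↦ P_n(a,a)`. -/
def logDerivP (α : ℝ) (n : ℕ) (a : ℝ) : ℝ :=
  (-(n * a) + (2 * n + 2 * α + 1) * (r α n a / R α n a)) / (1 - a ^ 2) - r α n a / a

/-- The weights `(1 + (-1)^(n+k))/2` from `∂_a P_n` and `((-1)^(n+k) - 1)/2` from `∂_x P_n` add up
to `(-1)^(n+k)`, so the two nonlocal sums merge into the telescoping one. -/
theorem hasDerivAt_eval_P (hα : 0 < α) (ha : 0 < a) (ha1 : a < 1) (n : ℕ) :
    HasDerivAt (fun t => (P α n t).eval t) ((P α n a).eval a * logDerivP α n a) a := by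
  have hc : 1 - a ^ 2 ≠ 0 := by nlinarith
  refine (hasCoeffDerivAt_P hα ha ha1 n).hasDerivAt_eval_self.congr_deriv ?_
  have h1 := one_sub_sq_mul_eval_derivative_P hα ha ha1 n
  have h2 := sum_neg_one_pow_mul_R hα ha ha1 n
  have h3 : ∑ k ∈ Finset.range n, (1 + (-1) ^ (n + k)) * R α k a / 2 +
      ∑ k ∈ Finset.range n, ((-1) ^ (n + k) - 1) * R α k a / 2 = -(r α n a / a) := by
    rw [← h2, ← Finset.sum_add_distrib]
    exact Finset.sum_congr rfl fun k _ => by ring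
  rw [eval_gapDeriv, logDerivP]
  refine mul_left_cancel₀ hc ?_
  rw [mul_add, h1]
  have h4 : (1 - a ^ 2) * ((P α n a).eval a * ((-(n * a) + (2 * n + 2 * α + 1) *
      (r α n a / R α n a)) / (1 - a ^ 2) - r α n a / a)) = (P α n a).eval a *
      ((-(n * a) + (2 * n + 2 * α + 1) * (r α n a / R α n a)) -
        (1 - a ^ 2) * (r α n a / a)) := by
    rw [mul_left_comm, mul_sub (1 - a ^ 2), mul_div_cancel₀ _ hc]
  rw [h4]
  linear_combination (1 - a ^ 2) * (P α n a).eval a * h3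

theorem hasDerivAt_jacobi (α : ℝ) (ha : 0 < a) (ha1 : a < 1) :
    HasDerivAt (fun t : ℝ => (1 - t ^ 2) ^ α)
      ((1 - a ^ 2) ^ α * (-(2 * α * a) / (1 - a ^ 2))) a := by
  have hc : 0 < 1 - a ^ 2 := by nlinarith
  have h1 : HasDerivAt (fun x : ℝ => 1 - x ^ 2) (-(2 * a)) a := by
    simpa using (hasDerivAt_pow 2 a).const_sub 1
  refine (h1.rpow_const (p := α) (Or.inl hc.ne')).congr_deriv ?_
  rw [Real.rpow_sub_one hc.ne']
  ring

theorem hasDerivAt_R (hα : 0 < α) (ha : 0 < a) (ha1 : a < 1) (n : ℕ) :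
    HasDerivAt (fun t => R α n t)
      (R α n a * (2 * logDerivP α n a - 2 * α * a / (1 - a ^ 2) + R α n a)) a := by
  have hh := (h_pos hα ha ha1 n).ne'
  have hy := hasDerivAt_eval_P hα ha ha1 n
  refine ((((hy.fun_pow 2).const_mul 2).fun_mul (hasDerivAt_jacobi α ha ha1)).fun_div
    (hasDerivAt_h hα ha ha1 n) hh).congr_deriv ?_
  rw [R]
  field_simp
  ring

theorem hasDerivAt_r_succ (hα : 0 < α) (ha : 0 < a) (ha1 : a < 1) (n : ℕ) :
    HasDerivAt (fun t => r α (n + 1) t) (r α (n + 1) a * (logDerivP α (n + 1) a +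
      logDerivP α n a - 2 * α * a / (1 - a ^ 2) + R α n a)) a := by
  have hh := (h_pos hα ha ha1 n).ne'
  refine (((((hasDerivAt_eval_P hα ha ha1 (n + 1)).const_mul 2).fun_mul
    (hasDerivAt_eval_P hα ha ha1 n)).fun_mul (hasDerivAt_jacobi α ha ha1)).fun_div
    (hasDerivAt_h hα ha ha1 n) hh).congr_deriv ?_
  rw [r, R]
  field_simp
  ring

/-- The Riccati equation for `r_n` before the elimination of `β_n`. -/
theorem hasDerivAt_r (hα : 0 < α) (ha : 0 < a) (ha1 : a < 1) (n : ℕ) :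
    HasDerivAt (fun t => r α n t) (((2 * n + 2 * α + 1) * (r α n a ^ 2 / R α n a) -
      (2 * n + 2 * α - 1) * β α n a * R α n a) / (1 - a ^ 2)) a := by
  rcases n with _ | n
  · simpa [r, β] using hasDerivAt_const a (0 : ℝ)
  · have hc : 1 - a ^ 2 ≠ 0 := by nlinarith
    refine (hasDerivAt_r_succ hα ha ha1 n).congr_deriv ?_
    have hR := mul_R hα ha ha1 n
    have hR0 := (R_pos hα ha ha1 n).ne'
    have hR1 := (R_pos hα ha ha1 (n + 1)).ne'
    -- Both sides are written in `r_{n+1}`, `R_{n+1}` and `R_n` alone.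
    have hb : β α (n + 1) a = r α (n + 1) a ^ 2 / (R α (n + 1) a * R α n a) := by
      rw [eq_div_iff (mul_ne_zero hR1 hR0), ← β_mul_R_mul_R hα ha ha1 n]
      ring
    have hr : r α n a = a * R α n a - r α (n + 1) a := by linarith
    rw [hb, logDerivP, logDerivP, hr]
    push_cast
    field_simp
    ring

end JacobiGap

end
open JacobiGap in
theorem mainTheorem5 (α : ℝ) (hα : 0 < α) (n : ℕ) (a : ℝ) (ha : 0 < a) (ha1 : a < 1) :
    ((JacobiGap.P α n a).Monic ∧ (JacobiGap.P α n a).natDegree = n) ∧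
    (∀ j : ℕ, j ≠ n → JacobiGap.pairing α a (JacobiGap.P α j a) (JacobiGap.P α n a) = 0) ∧
    0 < JacobiGap.h α n a ∧
    (Polynomial.X * JacobiGap.P α 0 a = JacobiGap.P α 1 a ∧
      Polynomial.X * JacobiGap.P α (n + 1) a =
        JacobiGap.P α (n + 2) a + Polynomial.C (JacobiGap.β α (n + 1) a) * JacobiGap.P α n a) ∧
    0 < JacobiGap.R α n a ∧
    0 < a * JacobiGap.R α n a + 2 * n + 2 * α + 1 ∧
    ((2 * n + 2 * α - 1 : ℝ) ≠ 0 →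
      JacobiGap.β α n a =
        (((1 - a ^ 2) * JacobiGap.r α n a ^ 2 + 2 * (n + α) * JacobiGap.r α n a
              + n ^ 2 + 2 * n * α) * JacobiGap.R α n a
            - (2 * n + 2 * α + 1) * a * JacobiGap.r α n a ^ 2)
          / ((2 * n + 2 * α - 1) * JacobiGap.R α n a
              * (a * JacobiGap.R α n a + 2 * n + 2 * α + 1))) ∧
    HasDerivAt (fun t : ℝ => JacobiGap.r α n t)
      (((a ^ 2 - 1) * JacobiGap.R α n a ^ 2
            + 2 * a * (2 * n + 2 * α + 1) * JacobiGap.R α n a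
            + (2 * n + 2 * α + 1) ^ 2) * JacobiGap.r α n a ^ 2
          / ((1 - a ^ 2) * JacobiGap.R α n a
              * (a * JacobiGap.R α n a + 2 * n + 2 * α + 1))
        - (2 * (n + α) * JacobiGap.R α n a * JacobiGap.r α n a
            + n * (n + 2 * α) * JacobiGap.R α n a)
          / ((1 - a ^ 2) * (a * JacobiGap.R α n a + 2 * n + 2 * α + 1))) a ∧
    HasDerivAt (fun t : ℝ => JacobiGap.R α n t)
      (JacobiGap.R α n a ^ 2
        + (2 * a ^ 2 * (n + α) - 2 * (a ^ 2 - 1) * JacobiGap.r α n a) / (a * (a ^ 2 - 1))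
            * JacobiGap.R α n a
        - 2 * (2 * n + 2 * α + 1) / (a ^ 2 - 1) * JacobiGap.r α n a) a := by
  have hc : 0 < 1 - a ^ 2 := by nlinarith
  have hR := R_pos hα ha ha1 n
  have hD : 0 < a * R α n a + 2 * n + 2 * α + 1 := by positivity
  have hq := quadratic_relation hα ha ha1 n
  refine ⟨⟨monic_P α n a, natDegree_P α n a⟩, fun j hj => ?_, h_pos hα ha ha1 n,
    ⟨X_mul_P_zero hα ha ha1, X_mul_P_succ hα ha ha1 n⟩, hR, hD, fun hn => ?_, ?_, ?_⟩
  · rw [pairing_eq_gapFunctional hα ha ha1, gapFunctional_P_mul_P hα ha ha1 hj]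
  · rw [eq_div_iff (mul_ne_zero (mul_ne_zero hn hR.ne') hD.ne'), ← hq]
    ring
  · refine (hasDerivAt_r hα ha ha1 n).congr_deriv ?_
    -- `β_n` enters only through `(2n + 2α - 1) β_n R_n`, so it is eliminated without assuming `2n +
    -- 2α - 1 ≠ 0`.
    rw [← eq_div_iff hD.ne'] at hq
    rw [hq]
    field_simp
    ring
  · refine (hasDerivAt_R hα ha ha1 n).congr_deriv ?_
    have hc' : a ^ 2 - 1 = -(1 - a ^ 2) := by ring
    rw [logDerivP, hc']
    field_simp
    ring
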